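/- **Theorem 3.** Consider a downlink cellular network in the plane $\mathbb{R}^2$. For each $\lambda>0$ the base stations form a homogeneous Poisson point process $\Phi$ of intensity $\lambda$, with points $x_0,x_1,\dots$ at distances $r_i=|x_i|$ from the origin. Station $i$ has a fading power $h_i\ge 0$ and a link state $u_i$ (in a measurable space). The pairs $(h_i,u_i)$ are i.i.d. and independent of $\Phi$, $h_i$ is independent of $u_i$, the law of $(h_i,u_i)$ does not depend on $\lambda$, and $\mathbb{E}[h_i]=1$. The path loss at distance $r\ge 0$ over a link in state $u$ is $L(r,u)\ge 0$, where $L$ is a measurable function that does not depend on $\lambda$ (one possible state means a path loss that is deterministic with the distance). It is physically feasible: for a link state $u$ distributed as the $u_i$ and some constant $L_0\in[0,\infty)$, almost surely $L(0,u)=L_0$; for each $r\ge0$, almost surely $L(r,u)\le L_0$; and $$\gamma=\mathbb{E}\Big[\int_0^\infty r\,L(r,u)\,dr\Big]\in(0,\infty).$$ Let the station closest to the origin (almost surely unique) be the serving one, with index $s$, and put $$\mathcal{I}_\lambda=\sum_{i:\,r_i>r_s}h_i\,L(r_i,u_i),\qquad \mathrm{SINR}_\lambda=\frac{h_s\,L(r_s,u_s)}{\mathcal{I}_\lambda+N_0},$$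 with a constant noise power $N_0>0$. Suppose that there is $\lambda_c\ge 0$ such that $\mathbb{E}[\mathcal{I}_{\lambda}^{-2}]<\infty$ for all $\lambda\ge\lambda_c$ with $\lambda>0$. Then for every $\theta_0\ge 0$ the average potential throughput tends to zero: $$\lim_{\lambda\to\infty}\lambda\,\log_2(1+\theta_0)\,\mathbb{P}\{\mathrm{SINR}_\lambda\ge\theta_0\}=0.$$ -/

import Mathlib

open MeasureTheory ProbabilityTheory Filter Topology
open scoped NNReal ENNReal

noncomputable section

namespace Cellular

/-- The Euclidean plane, in which the base stations live; its `volume` is Lebesgue measure. -/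
abbrev Plane : Type := EuclideanSpace ℝ (Fin 2)

/-- The number of points of the random configuration `(X i)` that lie in `B`,
counted with multiplicity. -/
def pointCount {Ω : Type*} (X : ℕ → Ω → Plane) (B : Set Plane) (ω : Ω) : ℕ∞ :=
  {i | X i ω ∈ B}.encard

/-- The random points `X 0, X 1, …` (listed in an arbitrary order) form a homogeneous Poisson point
process of intensity `lam > 0` on the plane: the number of points in a Borel set `B` of finite area
is Poisson with mean `lam * area B`, and the numbers of points in pairwise disjoint Borel sets are
independent. -/
structure IsPoissonProcess {Ω : Type*} [MeasurableSpace Ω] (P : Measure Ω) (lam : ℝ)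
    (X : ℕ → Ω → Plane) : Prop where
  measurable_point : ∀ i, Measurable (X i)
  law_count : ∀ B : Set Plane, MeasurableSet B → volume B ≠ ∞ →
    HasLaw (pointCount X B)
      ((poissonMeasure (lam * (volume B).toReal).toNNReal).map (fun n : ℕ => (n : ℕ∞))) P
  indep_count : ∀ (n : ℕ) (B : Fin n → Set Plane), (∀ k, MeasurableSet (B k)) →
    Pairwise (fun k l => Disjoint (B k) (B l)) → iIndepFun (fun k => pointCount X (B k)) P

/-- The expected integral `γ = E [∫₀^∞ r L(r) dr]` of a path loss function, where `L r u` is the path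
loss at distance `r` over a link in state `u`, and `Q` is the law of the link state. -/
def pathLossIntegral {M : Type*} [MeasurableSpace M] (Q : Measure M) (L : ℝ → M → ℝ≥0) : ℝ≥0∞ :=
  ∫⁻ u, (∫⁻ r in Set.Ioi (0 : ℝ), ENNReal.ofReal r * (L r u : ℝ≥0∞)) ∂Q

/-- Physically feasible path loss. A path loss that is a deterministic function of the
distance is the case of a one-point space `M` of link states. Only distances `r ≥ 0` matter. -/
structure IsFeasiblePathLoss {M : Type*} [MeasurableSpace M] (Q : Measure M)
    (L : ℝ → M → ℝ≥0) : Prop where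
  measurable : Measurable (fun p : ℝ × M => L p.1 p.2)
  bounded : ∃ L₀ : ℝ≥0, (∀ᵐ u ∂Q, L 0 u = L₀) ∧ ∀ r : ℝ, 0 ≤ r → ∀ᵐ u ∂Q, L r u ≤ L₀
  integral_ne_zero : pathLossIntegral Q L ≠ 0
  integral_ne_top : pathLossIntegral Q L ≠ ∞

/-- A downlink network of density `lam`: base stations at the points `X i` of a Poisson process of
intensity `lam`; station `i` has the fading power `h i` of law `ν` and the link state `u i` of
law `Q` towards the user at the origin. Fading and link state are independent of each other, i.i.d.
over the stations, and independent of the positions of the stations. -/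
structure IsNetwork {Ω M : Type*} [MeasurableSpace Ω] [MeasurableSpace M] (P : Measure Ω)
    (ν : Measure ℝ≥0) (Q : Measure M) (lam : ℝ) (X : ℕ → Ω → Plane) (h : ℕ → Ω → ℝ≥0)
    (u : ℕ → Ω → M) : Prop where
  poisson : IsPoissonProcess P lam X
  measurable_fading : ∀ i, Measurable (h i)
  measurable_link : ∀ i, Measurable (u i)
  law_mark : ∀ i, HasLaw (fun ω => (h i ω, u i ω)) (ν.prod Q) P
  indep_marks : iIndepFun (fun i ω => (h i ω, u i ω)) P
  indep_points_marks : IndepFun (fun ω i => X i ω) (fun ω i => (h i ω, u i ω)) P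

/-- The index of the serving base station, the one closest to the origin. It is almost surely
unique; a tie would be resolved by the smallest index. -/
def servingIndex {Ω : Type*} (X : ℕ → Ω → Plane) (ω : Ω) : ℕ :=
  sInf {i | ∀ j, ‖X i ω‖ ≤ ‖X j ω‖}

open Classical in
/-- The interference `I = ∑ h i * L (r i)` at the origin, over all base stations outside
the closed ball about the origin whose radius is the distance of the serving station. -/
def interference {Ω M : Type*} (L : ℝ → M → ℝ≥0) (X : ℕ → Ω → Plane) (h : ℕ → Ω → ℝ≥0)
    (u : ℕ → Ω → M) (ω : Ω) : ℝ≥0∞ :=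
  ∑' i, if X i ω ∈ Metric.closedBall (0 : Plane) ‖X (servingIndex X ω) ω‖ then 0
    else (h i ω : ℝ≥0∞) * (L ‖X i ω‖ (u i ω) : ℝ≥0∞)

/-- The signal to interference plus noise ratio of the user at the origin, with noise power `N₀`. -/
def sinr {Ω M : Type*} (L : ℝ → M → ℝ≥0) (N₀ : ℝ≥0) (X : ℕ → Ω → Plane) (h : ℕ → Ω → ℝ≥0)
    (u : ℕ → Ω → M) (ω : Ω) : ℝ≥0∞ :=
  ((h (servingIndex X ω) ω : ℝ≥0∞) *
      (L ‖X (servingIndex X ω) ω‖ (u (servingIndex X ω) ω) : ℝ≥0∞)) /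
    (interference L X h u ω + (N₀ : ℝ≥0∞))

/-- The average potential throughput `lam * log₂ (1 + θ₀) * P (SINR ≥ θ₀)`. -/
def avgPotentialThroughput {Ω M : Type*} [MeasurableSpace Ω] (P : Measure Ω) (lam : ℝ)
    (L : ℝ → M → ℝ≥0) (N₀ : ℝ≥0) (X : ℕ → Ω → Plane) (h : ℕ → Ω → ℝ≥0) (u : ℕ → Ω → M)
    (θ₀ : ℝ) : ℝ :=
  lam * Real.logb 2 (1 + θ₀) * P.real {ω | ENNReal.ofReal θ₀ ≤ sinr L N₀ X h u ω}

end Cellular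

end

noncomputable section

namespace Cellular

/-! The signal stays bounded in distribution while the interference grows linearly in `lam`; the
point is to beat the extra factor `lam`. Feasibility of the path loss gives a region `B` of positive
finite area, outside a ball of radius `δ` about the origin, where one station's received power has
Laplace transform at most some `q < 1` (`IsFeasiblePathLoss.exists_region`).

If the SINR reaches `θ₀`, one of three things happens (`IsNetwork.measure_sinr_ge_le`). The ball of
radius `δ` may be empty, which is exponentially unlikely in `lam`. Otherwise all stations in `B`
interfere, and their total power may be at most `lam * c`; by Chernoff's bound
(`IsNetwork.measure_sum_le`) this too is exponentially unlikely when `c` is small. Otherwise the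
serving fading exceeds a constant times `lam`. The serving index depends on positions only, so this
fading has law `ν`, and since `ν` has finite mean that tail is `o(1 / lam)`
(`tendsto_mul_measureReal_le`). -/

/-! ### Poisson counts -/

/-- The probability generating function of a Poisson variable. -/
theorem lintegral_pow_poissonMeasure (r : ℝ≥0) {q : ℝ} (hq : 0 ≤ q) :
    ∫⁻ n, ENNReal.ofReal q ^ n ∂(poissonMeasure r) = ENNReal.ofReal (Real.exp (-(r * (1 - q)))) := by
  have hs : HasSum (fun n : ℕ => Real.exp (-r) * (r : ℝ) ^ n / (n.factorial : ℝ) * q ^ n)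
      (Real.exp (-(r * (1 - q)))) := by
    have h := (NormedSpace.expSeries_div_hasSum_exp ((r : ℝ) * q)).mul_left (Real.exp (-(r : ℝ)))
    rw [← Real.exp_eq_exp_ℝ, ← Real.exp_add] at h
    convert! h using 1
    · funext n; rw [mul_pow]; ring
    · congr 1; ring
  rw [poissonMeasure, lintegral_sum_measure]
  simp_rw [lintegral_smul_measure, lintegral_dirac, smul_eq_mul, ← ENNReal.ofReal_pow hq]
  rw [← hs.tsum_eq, ENNReal.ofReal_tsum_of_nonneg (fun n => by positivity) hs.summable]
  refine tsum_congr fun n => ?_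
  rw [ENNReal.ofReal_mul (by positivity)]

/-- The Poisson law charges only finite values. Local finiteness is what provides a nearest station
and makes products over the points of `B` eventually constant. -/
theorem IsPoissonProcess.ae_pointCount_ne_top {Ω : Type*} [MeasurableSpace Ω] {P : Measure Ω}
    {lam : ℝ} {X : ℕ → Ω → Plane} (hX : IsPoissonProcess P lam X) {B : Set Plane}
    (hB : MeasurableSet B) (hv : volume B ≠ ∞) : ∀ᵐ ω ∂P, pointCount X B ω ≠ ⊤ := by
  have h := hX.law_count B hB hv
  rw [ae_iff]
  have := h.measure_eq (p := fun k => ¬ k ≠ ⊤) (MeasurableSet.of_discrete)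
  rw [this, Measure.map_apply .of_discrete .of_discrete]
  have hemp : (fun n : ℕ => (n : ℕ∞)) ⁻¹' {k | ¬ k ≠ ⊤} = ∅ := by ext n; simp
  rw [hemp, measure_empty]

/-- The void probabilities of a Poisson process. -/
theorem IsPoissonProcess.measure_pointCount_eq_zero {Ω : Type*} [MeasurableSpace Ω] {P : Measure Ω}
    {lam : ℝ} (hlam : 0 ≤ lam) {X : ℕ → Ω → Plane} (hX : IsPoissonProcess P lam X) {B : Set Plane}
    (hB : MeasurableSet B) (hv : volume B ≠ ∞) :
    P {ω | pointCount X B ω = 0} = ENNReal.ofReal (Real.exp (-(lam * (volume B).toReal))) := by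
  have h := hX.law_count B hB hv
  rw [h.measure_eq (p := fun k => k = 0) (MeasurableSet.of_discrete),
    Measure.map_apply .of_discrete .of_discrete]
  have : (fun n : ℕ => (n : ℕ∞)) ⁻¹' {x | x = 0} = {0} := by ext n; simp
  rw [this, poissonMeasure_singleton]
  simp [Real.coe_toNNReal _ (show 0 ≤ lam * (volume B).toReal by positivity)]

open Classical in
/-- A bound for the generating functional of a Poisson process. -/
theorem IsPoissonProcess.lintegral_iInf_prod_le {Ω : Type*} [MeasurableSpace Ω] {P : Measure Ω}
    {lam : ℝ} (hlam : 0 ≤ lam) {X : ℕ → Ω → Plane} (hX : IsPoissonProcess P lam X) {B : Set Plane}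
    (hB : MeasurableSet B) (hv : volume B ≠ ∞) {q : ℝ} (hq : 0 ≤ q) :
    ∫⁻ ω, ⨅ n, ∏ i ∈ Finset.range n, (if X i ω ∈ B then ENNReal.ofReal q else 1) ∂P ≤
      ENNReal.ofReal (Real.exp (-(lam * (volume B).toReal * (1 - q)))) := by
  have h := hX.law_count B hB hv
  have hle : ∫⁻ ω, ⨅ n, ∏ i ∈ Finset.range n, (if X i ω ∈ B then ENNReal.ofReal q else 1) ∂P ≤
      ∫⁻ ω, ENNReal.ofReal q ^ (pointCount X B ω).toNat ∂P := by
    refine lintegral_mono_ae ?_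
    filter_upwards [hX.ae_pointCount_ne_top hB hv] with ω hω
    have hfin : {i | X i ω ∈ B}.Finite := Set.encard_ne_top_iff.mp hω
    obtain ⟨N, hN⟩ := hfin.bddAbove
    -- All indices of points in `B` are at most `N`, so `range (N + 1)` contains them all.
    refine (iInf_le _ (N + 1)).trans (le_of_eq ?_)
    rw [Finset.prod_ite]
    simp only [Finset.prod_const, one_pow, mul_one]
    refine congrArg (ENNReal.ofReal q ^ ·) ?_
    rw [pointCount, ← Set.ncard_def, ← Set.ncard_coe_finset]
    refine congrArg Set.ncard ?_
    ext i
    simp only [Finset.coe_filter, Finset.mem_range, Set.mem_ofPred_eq, and_iff_right_iff_imp]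
    exact fun hi => Nat.lt_succ_of_le (hN hi)
  refine hle.trans ?_
  have hmap : ∫⁻ ω, ENNReal.ofReal q ^ (pointCount X B ω).toNat ∂P =
      ∫⁻ k, ENNReal.ofReal q ^ k.toNat ∂(P.map (pointCount X B)) :=
    (lintegral_map' (f := fun k : ℕ∞ => ENNReal.ofReal q ^ k.toNat)
      (Measurable.of_discrete).aemeasurable h.aemeasurable).symm
  rw [hmap, h.map_eq, lintegral_map .of_discrete .of_discrete]
  simp only [ENat.toNat_natCast]
  rw [lintegral_pow_poissonMeasure _ hq, Real.coe_toNNReal _ (by positivity)]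

/-! ### Marks and Chernoff's bound -/

/-- Given the points, the marks are independent with law `ν.prod Q`. -/
theorem IsNetwork.lintegral_prod_marks {Ω M : Type*} [MeasurableSpace Ω] [MeasurableSpace M]
    {P : Measure Ω} [IsProbabilityMeasure P] {ν : Measure ℝ≥0} [IsProbabilityMeasure ν]
    {Q : Measure M} [IsProbabilityMeasure Q] {lam : ℝ}
    {X : ℕ → Ω → Plane} {h : ℕ → Ω → ℝ≥0} {u : ℕ → Ω → M} (hn : IsNetwork P ν Q lam X h u)
    {f : Plane → ℝ≥0 × M → ℝ≥0∞} (hf : Measurable (Function.uncurry f)) (n : ℕ) :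
    ∫⁻ ω, ∏ i ∈ Finset.range n, f (X i ω) (h i ω, u i ω) ∂P =
      ∫⁻ ω, ∏ i ∈ Finset.range n, ∫⁻ m, f (X i ω) m ∂(ν.prod Q) ∂P := by
  have hXm : Measurable fun ω i => X i ω := measurable_pi_lambda _ hn.poisson.measurable_point
  have hYi : ∀ i, Measurable fun ω => (h i ω, u i ω) := fun i =>
    (hn.measurable_fading i).prodMk (hn.measurable_link i)
  have hYm : Measurable fun ω i => (h i ω, u i ω) := measurable_pi_lambda _ hYi
  have hjoint := (indepFun_iff_map_prod_eq_prod_map_map hXm.aemeasurable hYm.aemeasurable).mp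
    hn.indep_points_marks
  have hF : Measurable fun p : (ℕ → Plane) × (ℕ → ℝ≥0 × M) =>
      ∏ i ∈ Finset.range n, f (p.1 i) (p.2 i) := by
    refine Finset.measurable_prod _ fun i _ => ?_
    have h1 : Measurable fun p : (ℕ → Plane) × (ℕ → ℝ≥0 × M) => (p.1 i, p.2 i) := by fun_prop
    exact hf.comp h1
  have hG : Measurable fun x : ℕ → Plane =>
      ∏ i ∈ Finset.range n, ∫⁻ m, f (x i) m ∂(ν.prod Q) := by
    refine Finset.measurable_prod _ fun i _ => ?_
    exact (hf.lintegral_prod_right').comp (measurable_pi_apply i)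
  have : IsProbabilityMeasure (P.map fun ω i => (h i ω, u i ω)) :=
    Measure.isProbabilityMeasure_map hYm.aemeasurable
  calc ∫⁻ ω, ∏ i ∈ Finset.range n, f (X i ω) (h i ω, u i ω) ∂P
      = ∫⁻ p, ∏ i ∈ Finset.range n, f (p.1 i) (p.2 i)
          ∂(P.map fun ω => ((fun i => X i ω), fun i => (h i ω, u i ω))) :=
        (lintegral_map hF (hXm.prodMk hYm)).symm
    _ = ∫⁻ x, ∫⁻ y, ∏ i ∈ Finset.range n, f (x i) (y i)
          ∂(P.map fun ω i => (h i ω, u i ω)) ∂(P.map fun ω i => X i ω) := by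
        rw [hjoint, lintegral_prod _ hF.aemeasurable]
    _ = ∫⁻ x, ∏ i ∈ Finset.range n, ∫⁻ m, f (x i) m ∂(ν.prod Q) ∂(P.map fun ω i => X i ω) := by
        -- With the positions frozen, the factors are functions of distinct independent marks.
        refine lintegral_congr fun x => ?_
        have hfx : ∀ i, Measurable (f (x i)) := fun i => hf.comp measurable_prodMk_left
        rw [lintegral_map (f := fun y => ∏ i ∈ Finset.range n, f (x i) (y i))
          (hF.comp measurable_prodMk_left) hYm]
        have hind : iIndepFun (fun i ω => f (x i) (h i ω, u i ω)) P :=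
          hn.indep_marks.comp (fun i => f (x i)) hfx
        rw [lintegral_prod_eq_prod_lintegral_of_indepFun (Finset.range n)
          (fun i ω => f (x i) (h i ω, u i ω)) hind (fun i => (hfx i).comp (hYi i))]
        refine Finset.prod_congr rfl fun i _ => ?_
        rw [← (hn.law_mark i).map_eq, lintegral_map (hfx i) (hYi i)]
    _ = _ := lintegral_map hG hXm

open Classical in
/-- Chernoff's bound for the sum of the received powers from a region `B`. -/
theorem IsNetwork.measure_sum_le {Ω M : Type*} [MeasurableSpace Ω] [MeasurableSpace M]
    {P : Measure Ω} [IsProbabilityMeasure P] {ν : Measure ℝ≥0} [IsProbabilityMeasure ν]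
    {Q : Measure M} [IsProbabilityMeasure Q] {lam : ℝ} (hlam : 0 ≤ lam)
    {X : ℕ → Ω → Plane} {h : ℕ → Ω → ℝ≥0} {u : ℕ → Ω → M} (hn : IsNetwork P ν Q lam X h u)
    {L : ℝ → M → ℝ≥0} (hL : Measurable fun p : ℝ × M => L p.1 p.2) {B : Set Plane}
    (hB : MeasurableSet B) (hv : volume B ≠ ∞) {q : ℝ} (hq : 0 ≤ q) (hq1 : q ≤ 1)
    (hphi : ∀ x ∈ B, ∫⁻ m, ENNReal.ofReal (Real.exp (-(m.1 * L ‖x‖ m.2 : ℝ≥0))) ∂(ν.prod Q) ≤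
      ENNReal.ofReal q) (c : ℝ≥0) :
    P {ω | ∀ n, ∑ i ∈ Finset.range n, (if X i ω ∈ B then h i ω * L ‖X i ω‖ (u i ω) else 0) ≤ c} ≤
      ENNReal.ofReal (Real.exp (c - lam * (volume B).toReal * (1 - q))) := by
  set f : Plane → ℝ≥0 × M → ℝ≥0∞ := fun x m =>
    if x ∈ B then ENNReal.ofReal (Real.exp (-(m.1 * L ‖x‖ m.2 : ℝ≥0))) else 1 with hfdef
  have hf : Measurable (Function.uncurry f) := by
    refine Measurable.ite (measurable_fst hB) ?_ measurable_const
    have h1 : Measurable fun p : Plane × (ℝ≥0 × M) => L ‖p.1‖ p.2.2 :=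
      hL.comp (measurable_fst.norm.prodMk measurable_snd.snd)
    exact (Real.measurable_exp.comp
      ((measurable_snd.fst.mul h1).coe_nnreal_real.neg)).ennreal_ofReal
  have hfprod : ∀ ω n, ∏ i ∈ Finset.range n, f (X i ω) (h i ω, u i ω) = ENNReal.ofReal (Real.exp
      (-(∑ i ∈ Finset.range n,
        (if X i ω ∈ B then h i ω * L ‖X i ω‖ (u i ω) else 0) : ℝ≥0))) := by
    intro ω n
    rw [NNReal.coe_sum, ← Finset.sum_neg_distrib, Real.exp_sum,
      ENNReal.ofReal_prod_of_nonneg fun i _ => (Real.exp_pos _).le]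
    refine Finset.prod_congr rfl fun i _ => ?_
    by_cases hi : X i ω ∈ B <;> simp [hfdef, hi]
  set E := {ω | ∀ n, ∑ i ∈ Finset.range n,
    (if X i ω ∈ B then h i ω * L ‖X i ω‖ (u i ω) else 0) ≤ c} with hE
  -- Markov's inequality for `exp` of minus the partial sum; integrating out the marks then leaves
  -- at most a factor `q` per point of `B`.
  have hstep : ∀ n, ENNReal.ofReal (Real.exp (-c)) * P E ≤
      ∫⁻ ω, ∏ i ∈ Finset.range n, (if X i ω ∈ B then ENNReal.ofReal q else 1) ∂P := by
    intro n
    calc ENNReal.ofReal (Real.exp (-c)) * P E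
        ≤ ENNReal.ofReal (Real.exp (-c)) * P {ω | ENNReal.ofReal (Real.exp (-c)) ≤
            ∏ i ∈ Finset.range n, f (X i ω) (h i ω, u i ω)} := by
          gcongr
          intro ω hω
          simp only [Set.mem_ofPred_eq]
          rw [hfprod]
          apply ENNReal.ofReal_le_ofReal
          rw [Real.exp_le_exp, neg_le_neg_iff, NNReal.coe_le_coe]
          exact hω n
      _ ≤ ∫⁻ ω, ∏ i ∈ Finset.range n, f (X i ω) (h i ω, u i ω) ∂P := by
          refine mul_meas_ge_le_lintegral (Finset.measurable_prod _ fun i _ => ?_) _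
          exact hf.comp ((hn.poisson.measurable_point i).prodMk
            ((hn.measurable_fading i).prodMk (hn.measurable_link i)))
      _ = ∫⁻ ω, ∏ i ∈ Finset.range n, ∫⁻ m, f (X i ω) m ∂(ν.prod Q) ∂P :=
          hn.lintegral_prod_marks hf n
      _ ≤ _ := by
          refine lintegral_mono fun ω => Finset.prod_le_prod' fun i _ => ?_
          by_cases hi : X i ω ∈ B
          · simpa [hfdef, hi] using hphi _ hi
          · simp [hfdef, hi]
  have hlim : ENNReal.ofReal (Real.exp (-c)) * P E ≤
      ENNReal.ofReal (Real.exp (-(lam * (volume B).toReal * (1 - q)))) := by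
    refine le_trans ?_ (hn.poisson.lintegral_iInf_prod_le hlam hB hv hq)
    rw [lintegral_iInf]
    · exact le_iInf hstep
    · exact fun n => Finset.measurable_prod _ fun i _ => Measurable.ite
        (hn.poisson.measurable_point i hB) measurable_const measurable_const
    -- Since `q ≤ 1` the products decrease, so monotone convergence moves the infimum out of the
    -- integral.
    · refine antitone_nat_of_succ_le fun n ω => ?_
      simp only [Finset.prod_range_succ]
      refine mul_le_of_le_one_right' ?_
      split_ifs
      · exact ENNReal.ofReal_le_one.mpr hq1
      · exact le_rfl
    · simp
  calc P E = ENNReal.ofReal (Real.exp c) * (ENNReal.ofReal (Real.exp (-c)) * P E) := by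
        rw [← mul_assoc, ← ENNReal.ofReal_mul (Real.exp_pos _).le, ← Real.exp_add,
          add_neg_cancel, Real.exp_zero, ENNReal.ofReal_one, one_mul]
    _ ≤ ENNReal.ofReal (Real.exp c) *
        ENNReal.ofReal (Real.exp (-(lam * (volume B).toReal * (1 - q)))) := by gcongr
    _ = _ := by
        rw [← ENNReal.ofReal_mul (Real.exp_pos _).le, ← Real.exp_add, ← sub_eq_add_neg]

/-! ### The serving station -/

/-- The index is a first hitting time of measurable events. When no minimiser exists `sInf ∅ = 0`;
the second alternative in `hex` then holds for every index, so `Nat.find` also returns `0`. -/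
theorem measurable_servingIndex {Ω : Type*} [MeasurableSpace Ω] {X : ℕ → Ω → Plane}
    (hX : ∀ i, Measurable (X i)) : Measurable (servingIndex X) := by
  classical
  have hA : ∀ i, MeasurableSet {ω | ∀ j, ‖X i ω‖ ≤ ‖X j ω‖} := fun i => by
    simp only [Set.ofPred_forall]
    exact MeasurableSet.iInter fun j => measurableSet_le (hX i).norm (hX j).norm
  have hex : ∀ ω, ∃ i, (∀ j, ‖X i ω‖ ≤ ‖X j ω‖) ∨ ∀ k, ¬ ∀ j, ‖X k ω‖ ≤ ‖X j ω‖ := fun ω => by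
    by_cases h : ∃ i, ∀ j, ‖X i ω‖ ≤ ‖X j ω‖
    · exact h.imp fun i hi => Or.inl hi
    · exact ⟨0, Or.inr (not_exists.mp h)⟩
  have heq : servingIndex X = fun ω => Nat.find (hex ω) := by
    funext ω
    by_cases h : ∃ i, ∀ j, ‖X i ω‖ ≤ ‖X j ω‖
    · rw [servingIndex, Nat.sInf_def (s := {i | ∀ j, ‖X i ω‖ ≤ ‖X j ω‖}) h]
      refine le_antisymm (Nat.find_mono fun i hi => ?_) (Nat.find_mono fun i hi => Or.inl hi)
      exact hi.resolve_right fun hk => h.elim hk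
    · have h0 : {i | ∀ j, ‖X i ω‖ ≤ ‖X j ω‖} = ∅ :=
        Set.eq_empty_iff_forall_notMem.mpr (not_exists.mp h)
      rw [servingIndex, h0, Nat.sInf_empty, eq_comm, Nat.find_eq_zero]
      exact Or.inr (not_exists.mp h)
  rw [heq]
  refine measurable_find hex fun i => ?_
  refine (hA i).union ?_
  have : {ω | ∀ k, ¬ ∀ j, ‖X k ω‖ ≤ ‖X j ω‖} = ⋂ k, {ω | ∀ j, ‖X k ω‖ ≤ ‖X j ω‖}ᶜ := by
    ext ω; simp
  change MeasurableSet {ω | ∀ k, ¬ ∀ j, ‖X k ω‖ ≤ ‖X j ω‖}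
  rw [this]
  exact MeasurableSet.iInter fun k => (hA k).compl

/-- If some ball contains at least one and at most finitely many of the points, then the serving
station lies in it. -/
theorem norm_servingIndex_le {Ω : Type*} {X : ℕ → Ω → Plane} {ω : Ω} {δ : ℝ}
    (h0 : pointCount X (Metric.closedBall 0 δ) ω ≠ 0)
    (h1 : pointCount X (Metric.closedBall 0 δ) ω ≠ ⊤) : ‖X (servingIndex X ω) ω‖ ≤ δ := by
  have hfin : {i | X i ω ∈ Metric.closedBall 0 δ}.Finite := Set.encard_ne_top_iff.mp h1
  have hne : {i | X i ω ∈ Metric.closedBall 0 δ}.Nonempty := Set.encard_ne_zero.mp h0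
  obtain ⟨i, hi, hmin⟩ := Set.exists_min_image _ (fun i => ‖X i ω‖) hfin hne
  simp only [Set.mem_ofPred_eq, mem_closedBall_zero_iff] at hi hmin
  have hall : ∀ j, ‖X i ω‖ ≤ ‖X j ω‖ := fun j => by
    by_cases hj : ‖X j ω‖ ≤ δ
    · exact hmin j hj
    · exact hi.trans (not_le.mp hj).le
  have hs : servingIndex X ω ∈ {i | ∀ j, ‖X i ω‖ ≤ ‖X j ω‖} := Nat.sInf_mem ⟨i, hall⟩
  exact (hs i).trans hi

/-- The fading power of the serving station has the same law as all the others. -/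
theorem IsNetwork.measure_serving_fading {Ω M : Type*} [MeasurableSpace Ω] [MeasurableSpace M]
    {P : Measure Ω} [IsProbabilityMeasure P] {ν : Measure ℝ≥0} {Q : Measure M}
    [IsProbabilityMeasure Q] {lam : ℝ} {X : ℕ → Ω → Plane} {h : ℕ → Ω → ℝ≥0} {u : ℕ → Ω → M}
    (hn : IsNetwork P ν Q lam X h u) {S : Set ℝ≥0} (hS : MeasurableSet S) :
    P {ω | h (servingIndex X ω) ω ∈ S} ≤ ν S := by
  have hm := measurable_servingIndex hn.poisson.measurable_point
  have hpi : Measurable (servingIndex fun i (x : ℕ → Plane) => x i) :=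
    measurable_servingIndex measurable_pi_apply
  have hlaw : ∀ n, P {ω | h n ω ∈ S} = ν S := fun n => by
    have := (hn.law_mark n).measure_eq (p := fun m => m.1 ∈ S) (measurable_fst hS)
    rw [this]
    have h2 : {m : ℝ≥0 × M | m.1 ∈ S} = S ×ˢ Set.univ := by ext; simp
    rw [h2, Measure.prod_prod, measure_univ, mul_one]
  -- The serving index is a function of the point sequence alone, hence independent of the marks.
  have hinter : ∀ n, P ({ω | servingIndex X ω = n} ∩ {ω | h n ω ∈ S}) =
      P {ω | servingIndex X ω = n} * ν S := fun n => by
    rw [← hlaw n]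
    have hx : MeasurableSet {x : ℕ → Plane | servingIndex (fun i (x : ℕ → Plane) => x i) x = n} :=
      hpi (measurableSet_singleton n)
    have hy : MeasurableSet {y : ℕ → ℝ≥0 × M | (y n).1 ∈ S} :=
      ((measurable_pi_apply n).fst) hS
    exact hn.indep_points_marks.measure_inter_preimage_eq_mul _ _ hx hy
  calc P {ω | h (servingIndex X ω) ω ∈ S}
      ≤ P (⋃ n, {ω | servingIndex X ω = n} ∩ {ω | h n ω ∈ S}) :=
        measure_mono fun ω hω => Set.mem_iUnion.mpr ⟨_, rfl, hω⟩
    _ ≤ ∑' n, P ({ω | servingIndex X ω = n} ∩ {ω | h n ω ∈ S}) := measure_iUnion_le _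
    _ = (∑' n, P {ω | servingIndex X ω = n}) * ν S := by
        simp_rw [hinter]; exact ENNReal.tsum_mul_right
    _ = ν S := by
        have : ∑' n, P {ω | servingIndex X ω = n} = P Set.univ := by
          rw [← measure_iUnion]
          · congr 1; ext ω; simp
          · intro i j hij
            exact Set.disjoint_left.mpr fun ω hi hj => hij (hi.symm.trans hj)
          · exact fun n => hm (measurableSet_singleton n)
        rw [this, measure_univ, one_mul]

/-- The null set in `hL₀` may depend on `r`, so it cannot be evaluated directly at a random
distance. Position and link state are independent, and Fubini removes the difficulty. -/
theorem IsNetwork.ae_pathLoss_le {Ω M : Type*} [MeasurableSpace Ω] [MeasurableSpace M]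
    {P : Measure Ω} [IsProbabilityMeasure P] {ν : Measure ℝ≥0} [IsProbabilityMeasure ν]
    {Q : Measure M} [IsProbabilityMeasure Q] {lam : ℝ} {X : ℕ → Ω → Plane} {h : ℕ → Ω → ℝ≥0}
    {u : ℕ → Ω → M} (hn : IsNetwork P ν Q lam X h u) {L : ℝ → M → ℝ≥0}
    (hL : Measurable fun p : ℝ × M => L p.1 p.2) {L₀ : ℝ≥0}
    (hL₀ : ∀ r : ℝ, 0 ≤ r → ∀ᵐ u ∂Q, L r u ≤ L₀) (i : ℕ) :
    ∀ᵐ ω ∂P, L ‖X i ω‖ (u i ω) ≤ L₀ := by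
  have hXi := hn.poisson.measurable_point i
  have hui := hn.measurable_link i
  have hφ : Measurable fun x : ℕ → Plane => x i := measurable_pi_apply i
  have hψ : Measurable fun y : ℕ → ℝ≥0 × M => (y i).2 := (measurable_pi_apply i).snd
  have hind : IndepFun (X i) (u i) P := hn.indep_points_marks.comp hφ hψ
  have hjoint := (indepFun_iff_map_prod_eq_prod_map_map hXi.aemeasurable hui.aemeasurable).mp hind
  have hu : P.map (u i) = Q := by
    have h2 := congrArg (Measure.map Prod.snd) (hn.law_mark i).map_eq
    rw [Measure.map_map measurable_snd ((hn.measurable_fading i).prodMk hui)] at h2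
    simpa [Measure.map_snd_prod, Function.comp_def] using h2
  have hset : MeasurableSet {p : Plane × M | L ‖p.1‖ p.2 ≤ L₀} :=
    measurableSet_le (hL.comp (measurable_fst.norm.prodMk measurable_snd)) measurable_const
  have hae : ∀ᵐ p ∂(P.map fun ω => (X i ω, u i ω)), L ‖p.1‖ p.2 ≤ L₀ := by
    rw [hjoint, hu, Measure.ae_prod_iff_ae_ae hset]
    exact Eventually.of_forall fun x => hL₀ _ (norm_nonneg x)
  exact (ae_map_iff (hXi.prodMk hui).aemeasurable hset).mp hae

/-! ### Tails of integrable variables -/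

/-- The tail of an integrable variable decays faster than linearly. -/
theorem tendsto_mul_measureReal_le {α : Type*} [MeasurableSpace α] {μ : Measure α}
    [IsFiniteMeasure μ] {Y : α → ℝ} (hY : Integrable Y μ) (hYm : Measurable Y)
    (hY0 : ∀ x, 0 ≤ Y x) :
    Tendsto (fun t : ℝ => t * μ.real {x | t ≤ Y x}) atTop (𝓝 0) := by
  have hS : ∀ t : ℝ, MeasurableSet {x | t ≤ Y x} := fun t => measurableSet_le measurable_const hYm
  -- Dominated convergence with `Y` itself as the bound: each point leaves `{t ≤ Y}` once `t` passes
  -- its value.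
  have hlim : Tendsto (fun t : ℝ => ∫ x, {x | t ≤ Y x}.indicator Y x ∂μ) atTop (𝓝 0) := by
    have := tendsto_integral_filter_of_dominated_convergence (μ := μ) (l := atTop)
      (F := fun t : ℝ => {x | t ≤ Y x}.indicator Y) (f := fun _ => (0 : ℝ)) Y
      (Eventually.of_forall fun t => (hYm.indicator (hS t)).aestronglyMeasurable)
      (Eventually.of_forall fun t => Eventually.of_forall fun x => by
        refine (norm_indicator_le_norm_self _ _).trans ?_
        rw [Real.norm_of_nonneg (hY0 x)]) hY
      (Eventually.of_forall fun x => by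
        refine tendsto_const_nhds.congr' ?_
        filter_upwards [eventually_gt_atTop (Y x)] with t ht
        rw [Set.indicator_of_notMem]
        exact not_le.mpr ht)
    simpa using this
  refine squeeze_zero' ?_ ?_ hlim
  · filter_upwards [eventually_ge_atTop (0 : ℝ)] with t ht
    positivity
  · refine Eventually.of_forall fun t => ?_
    rw [integral_indicator (hS t)]
    calc t * μ.real {x | t ≤ Y x} = ∫ _ in {x | t ≤ Y x}, t ∂μ := by
          rw [setIntegral_const, smul_eq_mul, mul_comm]
      _ ≤ ∫ x in {x | t ≤ Y x}, Y x ∂μ :=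
          setIntegral_mono_on (integrable_const _).integrableOn hY.integrableOn (hS t)
            fun x hx => hx

/-! ### The region of interferers -/

/-- A set of distances `r > 0` of positive length corresponds to a region of positive area. -/
theorem volume_norm_preimage_ne_zero {R : Set ℝ} (hR : MeasurableSet R) {a b : ℝ} (ha : 0 < a)
    (hRab : R ⊆ Set.Ioo a b) (hR0 : volume R ≠ 0) :
    volume {x : Plane | ‖x‖ ∈ R} ≠ 0 := by
  intro hzero
  have hB : MeasurableSet {x : Plane | ‖x‖ ∈ R} := measurable_norm hR
  -- Polar coordinates: the area is a nonzero multiple of `∫ y in R, y`.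
  have h := integral_fun_norm_addHaar (volume : Measure Plane) (R.indicator fun _ => (1 : ℝ))
  have hlhs : ∫ x : Plane, R.indicator (fun _ => (1 : ℝ)) ‖x‖ = 0 := by
    have : (fun x : Plane => R.indicator (fun _ => (1 : ℝ)) ‖x‖) =
        {x : Plane | ‖x‖ ∈ R}.indicator fun _ => (1 : ℝ) := by
      funext x; by_cases hx : ‖x‖ ∈ R <;> simp [hx]
    rw [this, integral_indicator_const _ hB, measureReal_def, hzero]
    simp
  have hball : (volume : Measure Plane).real (Metric.ball 0 1) ≠ 0 :=
    (ENNReal.toReal_pos (Metric.measure_ball_pos _ _ one_pos).ne' measure_ball_lt_top.ne).ne'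
  have hint : ∫ y in Set.Ioi (0 : ℝ), y ^ (Module.finrank ℝ Plane - 1) •
      R.indicator (fun _ => (1 : ℝ)) y = ∫ y in R, y := by
    rw [← integral_indicator hR, ← integral_indicator measurableSet_Ioi]
    refine integral_congr_ae (Eventually.of_forall fun y => ?_)
    by_cases hy : y ∈ R
    · have : 0 < y := ha.trans (hRab hy).1
      simp [hy, this]
    · simp [hy]
  have hRfin : volume R ≠ ∞ := ((measure_mono hRab).trans_lt measure_Ioo_lt_top).ne
  have hpos : 0 < ∫ y in R, y := by
    have hInt : IntegrableOn (fun y : ℝ => y) R :=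
      (continuous_id.integrableOn_Icc (a := a) (b := b)).mono_set
        (hRab.trans Set.Ioo_subset_Icc_self)
    calc 0 < a * volume.real R := mul_pos ha (ENNReal.toReal_pos hR0 hRfin)
      _ = ∫ _ in R, a := by rw [setIntegral_const, smul_eq_mul, mul_comm]
      _ ≤ ∫ y in R, y := setIntegral_mono_on (integrableOn_const hRfin) hInt hR
          fun y hy => (hRab hy).1.le
  rw [hlhs, hint] at h
  have hdim : Module.finrank ℝ Plane ≠ 0 := by simp
  simp only [nsmul_eq_mul, smul_eq_mul, zero_eq_mul, Nat.cast_eq_zero] at h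
  rcases h with h | h
  · exact hdim h
  · exact mul_ne_zero hball hpos.ne' h

/-- A region of positive finite area, away from the origin, in which the Laplace transform of the
received power of a single station is bounded away from one. -/
theorem IsFeasiblePathLoss.exists_region {M : Type*} [MeasurableSpace M]
    {ν : Measure ℝ≥0} [IsProbabilityMeasure ν] (hν : ∫⁻ x, (x : ℝ≥0∞) ∂ν = 1)
    {Q : Measure M} [IsProbabilityMeasure Q] {L : ℝ → M → ℝ≥0} (hL : IsFeasiblePathLoss Q L) :
    ∃ (B : Set Plane) (δ q : ℝ), MeasurableSet B ∧ volume B ≠ ∞ ∧ volume B ≠ 0 ∧ 0 < δ ∧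
      (∀ x ∈ B, δ < ‖x‖) ∧ 0 ≤ q ∧ q < 1 ∧
      ∀ x ∈ B, ∫⁻ m, ENNReal.ofReal (Real.exp (-(m.1 * L ‖x‖ m.2 : ℝ≥0))) ∂(ν.prod Q) ≤
        ENNReal.ofReal q := by
  have hLm := hL.measurable
  set φ : ℝ → ℝ≥0∞ := fun r =>
    ∫⁻ m, ENNReal.ofReal (Real.exp (-(m.1 * L r m.2 : ℝ≥0))) ∂(ν.prod Q) with hφ
  have hjm : Measurable fun p : ℝ × (ℝ≥0 × M) =>
      ENNReal.ofReal (Real.exp (-(p.2.1 * L p.1 p.2.2 : ℝ≥0))) := by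
    have h1 : Measurable fun p : ℝ × (ℝ≥0 × M) => L p.1 p.2.2 :=
      hLm.comp (measurable_fst.prodMk measurable_snd.snd)
    exact (Real.measurable_exp.comp
      ((measurable_snd.fst.mul h1).coe_nnreal_real.neg)).ennreal_ofReal
  have hφm : Measurable φ := hjm.lintegral_prod_right'
  have hone : ∀ t : ℝ≥0, ENNReal.ofReal (Real.exp (-t)) ≤ 1 := fun t =>
    ENNReal.ofReal_le_one.mpr (Real.exp_le_one_iff.mpr (neg_nonpos.mpr t.2))
  -- A Laplace transform of at least one forces the power to vanish almost surely; its mean factors,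
  -- and the fading has mean one, so the mean path loss is zero.
  have hzero : ∀ r, 1 ≤ φ r → ∫⁻ u, (L r u : ℝ≥0∞) ∂Q = 0 := by
    intro r hr
    have hrm : Measurable (L r) := hLm.comp measurable_prodMk_left
    have hpm : Measurable fun m : ℝ≥0 × M => m.1 * L r m.2 :=
      measurable_fst.mul (hrm.comp measurable_snd)
    have hae : ∀ᵐ m ∂(ν.prod Q), m.1 * L r m.2 = 0 := by
      have h1 := ae_eq_of_ae_le_of_lintegral_le (μ := ν.prod Q)
        (f := fun m => ENNReal.ofReal (Real.exp (-(m.1 * L r m.2 : ℝ≥0)))) (g := fun _ => 1)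
        (Eventually.of_forall fun m => hone _)
        ((lintegral_mono fun m => hone _).trans_lt (by simp)).ne aemeasurable_const
        (by rwa [lintegral_one, measure_univ])
      filter_upwards [h1] with m hm
      rw [ENNReal.ofReal_eq_one, Real.exp_eq_one_iff, neg_eq_zero] at hm
      exact_mod_cast hm
    have h2 : ∫⁻ m, (m.1 : ℝ≥0∞) * (L r m.2 : ℝ≥0∞) ∂(ν.prod Q) = 0 := by
      rw [lintegral_eq_zero_iff (by fun_prop)]
      filter_upwards [hae] with m hm
      simp only [Pi.zero_apply]
      exact_mod_cast hm
    rw [lintegral_prod_mul (f := fun x : ℝ≥0 => (x : ℝ≥0∞)) (g := fun v => (L r v : ℝ≥0∞))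
      measurable_coe_nnreal_ennreal.aemeasurable hrm.coe_nnreal_ennreal.aemeasurable, hν,
      one_mul] at h2
    exact h2
  -- The sets `R n` exhaust `{r > 0 | φ r < 1}`. If all were null, Tonelli's theorem would make the
  -- path loss integral vanish.
  set q : ℕ → ℝ := fun n => 1 - 1 / ((n : ℝ) + 1) with hqdef
  set R : ℕ → Set ℝ := fun n =>
    Set.Ioo (1 / ((n : ℝ) + 1)) n ∩ {r | φ r ≤ ENNReal.ofReal (q n)} with hRdef
  have hRm : ∀ n, MeasurableSet (R n) := fun n =>
    measurableSet_Ioo.inter (measurableSet_le hφm measurable_const)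
  obtain ⟨n, hn⟩ : ∃ n, volume (R n) ≠ 0 := by
    by_contra! hall
    have hU : volume (⋃ n, R n) = 0 := measure_iUnion_null hall
    have hsub : ∀ r, 0 < r → r ∉ ⋃ n, R n → 1 ≤ φ r := by
      intro r hr hnot
      by_contra! hlt
      apply hnot
      have hfin : φ r ≠ ∞ := (hlt.trans ENNReal.one_lt_top).ne
      have hlt' : (φ r).toReal < 1 := by
        rw [← ENNReal.toReal_one]; exact (ENNReal.toReal_lt_toReal hfin ENNReal.one_ne_top).mpr hlt
      -- One index `k` handles both the lower cutoff on `r` and the gap `1 - φ r`; `l` handles the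
      -- upper cutoff.
      obtain ⟨k, hk⟩ := exists_nat_one_div_lt (lt_min hr (sub_pos.mpr hlt'))
      obtain ⟨l, hl⟩ := exists_nat_gt r
      refine Set.mem_iUnion.mpr ⟨max k l, ⟨?_, ?_⟩, ?_⟩
      · refine lt_of_le_of_lt ?_ (hk.trans_le (min_le_left _ _))
        exact one_div_le_one_div_of_le (by positivity) (by simp)
      · exact hl.trans_le (by simp)
      · change φ r ≤ ENNReal.ofReal (q (max k l))
        refine ENNReal.le_ofReal_iff_toReal_le hfin ?_ |>.mpr ?_
        · have : 1 / (((max k l : ℕ) : ℝ) + 1) ≤ 1 := by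
            rw [div_le_one (by positivity)]; simp
          simpa [hqdef] using this
        · have h1 : 1 / (((max k l : ℕ) : ℝ) + 1) ≤ 1 / ((k : ℝ) + 1) :=
            one_div_le_one_div_of_le (by positivity) (by simp)
          have h2 := hk.trans_le (min_le_right _ _)
          simp only [hqdef]
          linarith
    apply hL.integral_ne_zero
    rw [pathLossIntegral, lintegral_lintegral_swap]
    · rw [setLIntegral_congr_fun_ae (g := fun _ => 0) measurableSet_Ioi]
      · simp
      · filter_upwards [measure_eq_zero_iff_ae_notMem.mp hU] with r hr hr0
        have hrm : Measurable (L r) := hLm.comp measurable_prodMk_left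
        rw [lintegral_const_mul _ hrm.coe_nnreal_ennreal, hzero r (hsub r hr0 hr), mul_zero]
    · have : Measurable fun p : M × ℝ => ENNReal.ofReal p.2 * (L p.2 p.1 : ℝ≥0∞) :=
        measurable_snd.ennreal_ofReal.mul
          (hLm.comp (measurable_snd.prodMk measurable_fst)).coe_nnreal_ennreal
      exact this.aemeasurable
  have hn0 : (0 : ℝ) < 1 / ((n : ℝ) + 1) := by positivity
  have hn1 : 1 / ((n : ℝ) + 1) ≤ 1 := by rw [div_le_one (by positivity)]; simp
  refine ⟨{x | ‖x‖ ∈ R n}, 1 / ((n : ℝ) + 1), q n, measurable_norm (hRm n), ?_,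
    volume_norm_preimage_ne_zero (hRm n) hn0 Set.inter_subset_left hn, hn0, fun x hx => hx.1.1,
    sub_nonneg.mpr hn1, sub_lt_self _ hn0, fun x hx => hx.2⟩
  refine ((measure_mono fun x hx => ?_).trans_lt
    (measure_ball_lt_top (μ := (volume : Measure Plane)) (x := 0) (r := n))).ne
  exact mem_ball_zero_iff.mpr hx.1.2

/-! ### Splitting the coverage event -/

open Classical in
/-- The three ways in which the SINR can be at least `θ`: the serving station is far away,
the interference is small, or the fading of the serving station is large. -/
theorem IsNetwork.measure_sinr_ge_le {Ω M : Type*} [MeasurableSpace Ω] [MeasurableSpace M]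
    {P : Measure Ω} [IsProbabilityMeasure P] {ν : Measure ℝ≥0} [IsProbabilityMeasure ν]
    {Q : Measure M} [IsProbabilityMeasure Q] {lam : ℝ}
    {X : ℕ → Ω → Plane} {h : ℕ → Ω → ℝ≥0} {u : ℕ → Ω → M} (hn : IsNetwork P ν Q lam X h u)
    {L : ℝ → M → ℝ≥0} (hL : Measurable fun p : ℝ × M => L p.1 p.2) {L₀ : ℝ≥0}
    (hL₀ : ∀ r : ℝ, 0 ≤ r → ∀ᵐ u ∂Q, L r u ≤ L₀) {B : Set Plane} {δ : ℝ}
    (hδ : ∀ x ∈ B, δ < ‖x‖) (N₀ θ c : ℝ≥0) :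
    P {ω | (θ : ℝ≥0∞) ≤ sinr L N₀ X h u ω} ≤
      P {ω | pointCount X (Metric.closedBall 0 δ) ω = 0} +
      P {ω | ∀ n, ∑ i ∈ Finset.range n,
        (if X i ω ∈ B then h i ω * L ‖X i ω‖ (u i ω) else 0) ≤ c} +
      ν {x | θ * c ≤ x * L₀} := by
  have hS : MeasurableSet {x : ℝ≥0 | θ * c ≤ x * L₀} :=
    measurableSet_le measurable_const (measurable_id.mul_const _)
  refine le_trans ?_ (add_le_add_right (hn.measure_serving_fading hS) _)
  refine le_trans ?_ (add_le_add_left (measure_union_le _ _) _)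
  refine le_trans ?_ (measure_union_le _ _)
  refine measure_mono_ae ?_
  filter_upwards [hn.poisson.ae_pointCount_ne_top (Metric.isClosed_closedBall (x := 0)
    (ε := δ)).measurableSet (measure_closedBall_lt_top).ne,
    ae_all_iff.mpr fun i => hn.ae_pathLoss_le hL hL₀ i] with ω htop hle hω
  by_contra! hnot
  have h1 : pointCount X (Metric.closedBall 0 δ) ω ≠ 0 := fun hh => hnot (Or.inl (Or.inl hh))
  have h2 : ¬ ∀ n, ∑ i ∈ Finset.range n,
      (if X i ω ∈ B then h i ω * L ‖X i ω‖ (u i ω) else 0) ≤ c :=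
    fun hh => hnot (Or.inl (Or.inr hh))
  have h3 : ¬ θ * c ≤ h (servingIndex X ω) ω * L₀ := fun hh => hnot (Or.inr hh)
  apply h3
  have hs := norm_servingIndex_le h1 htop
  push Not at h2
  obtain ⟨n, hc⟩ := h2
  -- The serving station is within `δ` and `B` lies beyond `δ`, so every station in `B` is an
  -- interferer.
  have hI : (c : ℝ≥0∞) ≤ interference L X h u ω := by
    refine le_trans ?_ (ENNReal.sum_le_tsum (Finset.range n))
    refine le_trans (ENNReal.coe_le_coe.mpr hc.le) ?_
    rw [ENNReal.ofNNReal_finsetSum]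
    refine Finset.sum_le_sum fun i _ => ?_
    by_cases hi : X i ω ∈ B
    · have : X i ω ∉ Metric.closedBall (0 : Plane) ‖X (servingIndex X ω) ω‖ := by
        rw [mem_closedBall_zero_iff, not_le]
        exact hs.trans_lt (hδ _ hi)
      rw [if_pos hi, if_neg this, ENNReal.coe_mul]
    · rw [if_neg hi]; simp
  have h4 : (θ : ℝ≥0∞) * (interference L X h u ω + N₀) ≤ h (servingIndex X ω) ω *
      L ‖X (servingIndex X ω) ω‖ (u (servingIndex X ω) ω) := ENNReal.mul_le_of_le_div hω
  have h5 : (θ : ℝ≥0∞) * c ≤ h (servingIndex X ω) ω * L₀ := by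
    refine le_trans ?_ (h4.trans ?_)
    · gcongr
      exact hI.trans le_self_add
    · gcongr
      exact hle _
  exact_mod_cast h5

theorem tendsto_mul_exp_neg_mul {a : ℝ} (ha : 0 < a) :
    Tendsto (fun t : ℝ => t * Real.exp (-(t * a))) atTop (𝓝 0) := by
  have h := (Real.tendsto_pow_mul_exp_neg_atTop_nhds_zero 1).comp
    (tendsto_id.atTop_mul_const ha)
  have h2 := h.const_mul a⁻¹
  rw [mul_zero] at h2
  refine h2.congr fun t => ?_
  simp only [Function.comp_apply, id, pow_one]
  field_simp

end Cellular

end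

/-! ### Conclusion -/

theorem theorem3 {M : Type*} [MeasurableSpace M]
    -- the law of the fading powers, of unit mean
    (ν : Measure ℝ≥0) [IsProbabilityMeasure ν] (hν : ∫⁻ x, (x : ℝ≥0∞) ∂ν = 1)
    -- the law of the link states and the path loss
    (Q : Measure M) [IsProbabilityMeasure Q]
    (L : ℝ → M → ℝ≥0) (hL : Cellular.IsFeasiblePathLoss Q L)
    -- the noise power
    (N₀ : ℝ≥0) (hN₀ : 0 < N₀)
    -- for each density `lam > 0` a network of that density, on a probability space of its own
    {Ω : ℝ → Type*} [∀ lam, MeasurableSpace (Ω lam)]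
    (P : ∀ lam, Measure (Ω lam)) [∀ lam, IsProbabilityMeasure (P lam)]
    (X : ∀ lam, ℕ → Ω lam → Cellular.Plane) (h : ∀ lam, ℕ → Ω lam → ℝ≥0)
    (u : ∀ lam, ℕ → Ω lam → M)
    (hnet : ∀ lam : ℝ, 0 < lam →
      Cellular.IsNetwork (P lam) ν Q lam (X lam) (h lam) (u lam))
    -- the second negative moment of the interference is finite at all large densities
    (hmom : ∃ lamc : ℝ, 0 ≤ lamc ∧ ∀ lam : ℝ, 0 < lam → lamc ≤ lam →
      ∫⁻ ω, (Cellular.interference L (X lam) (h lam) (u lam) ω ^ 2)⁻¹ ∂(P lam) < ∞) :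
    ∀ θ₀ : ℝ, 0 ≤ θ₀ →
      Tendsto (fun lam : ℝ =>
        Cellular.avgPotentialThroughput (P lam) lam L N₀ (X lam) (h lam) (u lam) θ₀)
        atTop (𝓝 0) := by
  classical
  intro θ₀ hθ₀
  rcases hθ₀.eq_or_lt with rfl | hθ
  -- For threshold zero the logarithm vanishes.
  · simp [Cellular.avgPotentialThroughput]
  obtain ⟨L₀, -, hL₀⟩ := hL.bounded
  obtain ⟨B, δ, q, hBm, hBtop, hB0, hδ, hBδ, hq0, hq1, hphi⟩ := hL.exists_region hν
  set v := (volume B).toReal with hv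
  have hvpos : 0 < v := ENNReal.toReal_pos hB0 hBtop
  set w := (volume (Metric.closedBall (0 : Cellular.Plane) δ)).toReal with hw
  have hwtop : volume (Metric.closedBall (0 : Cellular.Plane) δ) ≠ ∞ :=
    measure_closedBall_lt_top.ne
  have hwpos : 0 < w := ENNReal.toReal_pos (Metric.measure_closedBall_pos _ _ hδ).ne' hwtop
  -- Half the Chernoff rate: with threshold `lam * c` the exponent is `lam * c - 2 * lam * c = -(lam
  -- * c)`.
  set c := v * (1 - q) / 2 with hc
  have hcpos : 0 < c := half_pos (mul_pos hvpos (sub_pos.mpr hq1))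
  -- Scaled so that `θ₀ * (lam * c) ≤ x * L₀` becomes `lam ≤ Y x`.
  set Y : ℝ≥0 → ℝ := fun x => x * (L₀ / (θ₀ * c)) with hY
  have hYint : Integrable Y ν := by
    refine Integrable.mul_const ?_ _
    refine ⟨measurable_coe_nnreal_real.aestronglyMeasurable, ?_⟩
    simp [HasFiniteIntegral, hν]
  have hYm : Measurable Y := measurable_coe_nnreal_real.mul_const _
  have hbound : ∀ lam : ℝ, 0 < lam →
      (P lam).real {ω | ENNReal.ofReal θ₀ ≤ Cellular.sinr L N₀ (X lam) (h lam) (u lam) ω} ≤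
        Real.exp (-(lam * w)) + Real.exp (-(lam * c)) + ν.real {x | lam ≤ Y x} := by
    intro lam hlam
    have hnw := hnet lam hlam
    have h1 := hnw.measure_sinr_ge_le hL.measurable hL₀ hBδ N₀ θ₀.toNNReal (lam * c).toNNReal
    have h2 := hnw.poisson.measure_pointCount_eq_zero hlam.le
      (Metric.isClosed_closedBall (x := 0) (ε := δ)).measurableSet hwtop
    have h3 := hnw.measure_sum_le hlam.le hL.measurable hBm hBtop hq0 hq1.le hphi
      (lam * c).toNNReal
    have h4 : {x : ℝ≥0 | θ₀.toNNReal * (lam * c).toNNReal ≤ x * L₀} = {x | lam ≤ Y x} := by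
      ext x
      simp only [Set.mem_ofPred_eq, hY]
      rw [← NNReal.coe_le_coe, NNReal.coe_mul, NNReal.coe_mul, Real.coe_toNNReal _ hθ.le,
        Real.coe_toNNReal _ (by positivity), ← mul_div_assoc (x : ℝ), le_div_iff₀ (by positivity),
        show θ₀ * (lam * c) = lam * (θ₀ * c) by ring]
    have h5 : ((lam * c).toNNReal : ℝ) - lam * v * (1 - q) = -(lam * c) := by
      rw [Real.coe_toNNReal _ (by positivity), hc]; ring
    rw [h5] at h3
    rw [h4, h2] at h1
    have h6 := h1.trans (add_le_add_left (add_le_add_right h3 _) _)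
    have h7 := ENNReal.toReal_mono (by finiteness) h6
    rwa [ENNReal.toReal_add (by finiteness) (by finiteness),
      ENNReal.toReal_add (by finiteness) (by finiteness),
      ENNReal.toReal_ofReal (Real.exp_pos _).le, ENNReal.toReal_ofReal (Real.exp_pos _).le] at h7
  have hlog : 0 ≤ Real.logb 2 (1 + θ₀) := Real.logb_nonneg one_lt_two (by linarith)
  have hlim : Tendsto (fun lam : ℝ => Real.logb 2 (1 + θ₀) * (lam * Real.exp (-(lam * w)) +
      lam * Real.exp (-(lam * c)) + lam * ν.real {x | lam ≤ Y x})) atTop (𝓝 0) := by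
    have := (((Cellular.tendsto_mul_exp_neg_mul hwpos).add
      (Cellular.tendsto_mul_exp_neg_mul hcpos)).add
      (Cellular.tendsto_mul_measureReal_le hYint hYm fun x => by positivity)).const_mul
      (Real.logb 2 (1 + θ₀))
    simpa using this
  refine squeeze_zero' ?_ ?_ hlim
  · filter_upwards [eventually_gt_atTop (0 : ℝ)] with lam hlam
    exact mul_nonneg (mul_nonneg hlam.le hlog) measureReal_nonneg
  · filter_upwards [eventually_gt_atTop (0 : ℝ)] with lam hlam
    calc _ ≤ lam * Real.logb 2 (1 + θ₀) * (Real.exp (-(lam * w)) + Real.exp (-(lam * c)) +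
          ν.real {x | lam ≤ Y x}) :=
          mul_le_mul_of_nonneg_left (hbound lam hlam) (mul_nonneg hlam.le hlog)
      _ = _ := by ring
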